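/- For an integer $n\ge 3$ let $P_n=\operatorname{conv}(1,\zeta_n,\dots,\zeta_n^{n-1})\subset\mathbb C=\mathbb R^2$, $\zeta_n=\cos(2\pi/n)+i\sin(2\pi/n)$, be the standard regular $n$-gon, and let $\operatorname{Hom}(P_n,P_3)$ be the polytope of all affine maps $f:P_n\to P_3$, a convex subset of the real vector space of affine maps $\mathbb R^2\to\mathbb R^2$. The rank of $f$ is the dimension of its image $f(P_n)$. Then for every $n\ge 3$ the number of vertices of $\operatorname{Hom}(P_n,P_3)$ of full rank, that is, of rank two, is finite and equal to $$\begin{cases}\dfrac{n(n+1)(n-1)}{4} & \text{for } n \text{ odd},\\[2mm] \dfrac{n(n-2)(n-4)}{4} & \text{for } n \text{ even}.\end{cases}$$ -/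

import Mathlib

/-- The root of unity `ζ_n = cos (2π / n) + sin (2π / n) i`. -/
noncomputable def zeta (n : ℕ) : ℂ :=
  ⟨Real.cos (2 * Real.pi / n), Real.sin (2 * Real.pi / n)⟩

/-- The standard regular `n`-gon `P_n = conv (1, ζ_n, ζ_n ^ 2, …, ζ_n ^ (n - 1))` in the real
plane `ℂ` (used for `n ≥ 3`). -/
noncomputable def regularPolygon (n : ℕ) : Set ℂ :=
  convexHull ℝ (Set.range fun k : Fin n => zeta n ^ (k : ℕ))

/-- The hom-polytope `Hom (P, Q)` of all affine maps `P → Q`, for a polytope `P` that affinely spans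
its ambient space `E`, as a subset of the real vector space of affine maps `E → E'`.
Since `P` spans `E`, an affine map on `P` is the same thing as an affine map on `E`; regular
polygons do span the plane, see `affineSpan_regularPolygon` below. -/
def homPolytope {E E' : Type*} [AddCommGroup E] [Module ℝ E] [AddCommGroup E'] [Module ℝ E']
    (P : Set E) (Q : Set E') : Set (E →ᵃ[ℝ] E') :=
  {f | ∀ x ∈ P, f x ∈ Q}

/-- The rank of an affine map `f` on `P`: the dimension of (the affine hull of) its image `f (P)`. -/
noncomputable def homRank {E E' : Type*} [AddCommGroup E] [Module ℝ E] [AddCommGroup E']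
    [Module ℝ E'] (P : Set E) (f : E →ᵃ[ℝ] E') : ℕ :=
  Module.finrank ℝ (vectorSpan ℝ (f '' P))

/-- The vertices of `Hom (P, Q)` (vertices of a polytope are its extreme points) of rank `r`. -/
def homVerticesOfRank {E E' : Type*} [AddCommGroup E] [Module ℝ E] [AddCommGroup E']
    [Module ℝ E'] (P : Set E) (Q : Set E') (r : ℕ) : Set (E →ᵃ[ℝ] E') :=
  {f | f ∈ Set.extremePoints ℝ (homPolytope P Q) ∧ homRank P f = r}

theorem affineSpan_regularPolygon (n : ℕ) (hn : 3 ≤ n) :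
    affineSpan ℝ (regularPolygon n) = ⊤ := by
  have hn' : (3 : ℝ) ≤ n := by exact_mod_cast hn
  have hpi := Real.pi_pos
  have hpos : 0 < 2 * Real.pi / n := by positivity
  have hlt : 2 * Real.pi / n < Real.pi := by
    rw [div_lt_iff₀ (by linarith)]; nlinarith
  have hs : 0 < Real.sin (2 * Real.pi / n) := Real.sin_pos_of_pos_of_lt_pi hpos hlt
  have hc : Real.cos (2 * Real.pi / n) < 1 := by
    nlinarith [Real.sin_sq_add_cos_sq (2 * Real.pi / n)]
  have hz : zeta n = Complex.exp (2 * Real.pi * Complex.I / n) := by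
    have h : (2 * Real.pi * Complex.I / n : ℂ) = ((2 * Real.pi / n : ℝ) : ℂ) * Complex.I := by
      push_cast; ring
    rw [h]
    apply Complex.ext
    · rw [Complex.exp_ofReal_mul_I_re, zeta]
    · rw [Complex.exp_ofReal_mul_I_im, zeta]
  have hzn : zeta n ^ n = 1 := by
    rw [hz]; exact (Complex.isPrimitiveRoot_exp n (by omega)).pow_eq_one
  have hconj : zeta n ^ (n - 1) = ⟨Real.cos (2 * Real.pi / n), -Real.sin (2 * Real.pi / n)⟩ := by
    have h0 : zeta n ≠ 0 := by rw [hz]; exact Complex.exp_ne_zero _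
    apply mul_right_cancel₀ h0
    rw [← pow_succ, Nat.sub_add_cancel (by omega), hzn]
    have h1 := Real.sin_sq_add_cos_sq (2 * Real.pi / n)
    apply Complex.ext <;> simp [zeta] <;> nlinarith
  have hmem : ∀ k < n, zeta n ^ k ∈ regularPolygon n := fun k hk =>
    subset_convexHull ℝ _ ⟨⟨k, hk⟩, rfl⟩
  have h0 := hmem 0 (by omega)
  have h1 := hmem 1 (by omega)
  have h2 := hmem (n - 1) (by omega)
  rw [hconj] at h2
  rw [pow_zero] at h0
  rw [pow_one] at h1
  rw [AffineSubspace.affineSpan_eq_top_iff_vectorSpan_eq_top_of_nonempty ℝ ℂ ℂ ⟨_, h0⟩,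
    eq_top_iff]
  intro w _
  have e1 := vsub_mem_vectorSpan ℝ h1 h0
  have e2 := vsub_mem_vectorSpan ℝ h2 h0
  set c := Real.cos (2 * Real.pi / n) with hcd
  set s := Real.sin (2 * Real.pi / n) with hsd
  have hc' : c - 1 ≠ 0 := by linarith
  have hw : w = (w.re / (2 * (c - 1)) + w.im / (2 * s)) • (zeta n -ᵥ 1) +
      (w.re / (2 * (c - 1)) - w.im / (2 * s)) • ((⟨c, -s⟩ : ℂ) -ᵥ 1) := by
    apply Complex.ext
    · simp only [zeta, ← hcd, ← hsd, Complex.add_re, Complex.smul_re, Complex.sub_re, vsub_eq_sub,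
        Complex.one_re, smul_eq_mul]
      field_simp; ring
    · simp only [zeta, ← hcd, ← hsd, Complex.add_im, Complex.smul_im, Complex.sub_im, vsub_eq_sub,
        Complex.one_im, smul_eq_mul]
      field_simp; ring
  rw [hw]
  exact Submodule.add_mem _ (Submodule.smul_mem _ _ e1) (Submodule.smul_mem _ _ e2)

/-!
Let `f` be an affine map of rank two, that is, bijective, from `P_n` to a triangle, and take the
barycentric coordinates of `f` in the triangle: three affine functions with sum `1` which are
nonnegative on `P_n`. A perturbation of `f` amounts to adding functions with sum `0` to them, and
for small ones nonnegativity only matters at the vertices of `P_n` where a coordinate vanishes. As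
`f` is invertible, it follows that `f` is a vertex of the hom-polytope if and only if each
coordinate is determined up to a scalar by its zeros among the vertices of `P_n`, that is, vanishes
on an edge.

Such an `f` is recovered from the three edges: their lines cut out a triangle circumscribed about
`P_n`, which `f` maps onto the target. Three edges arise in this way if and only if their outer
normals are positively dependent, that is, form an acute triangle inscribed in the unit circle. The
normals are a rotated copy of the vertices of `P_n`, so one has to count the ordered acute triangles
in a regular `n`-gon: there are two orientations, `n` first vertices, and then the pairs of arcs
which, like their complement, are shorter than half of the circle.
-/

open scoped ComplexConjugate InnerProductSpace Pointwise
open ZMod (stdAddChar)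

/-! ### Hom-polytopes into a simplex -/

section HomSimplex

variable {E V ι : Type*} [AddCommGroup E] [Module ℝ E] [AddCommGroup V] [Module ℝ V]

theorem eq_zero_of_mem_extremePoints_of_add_mem_of_sub_mem {C : Set V} {x d : V}
    (hx : x ∈ C.extremePoints ℝ) (hadd : x + d ∈ C) (hsub : x - d ∈ C) : d = 0 := by
  have hmid : x ∈ openSegment ℝ (x + d) (x - d) :=
    ⟨1 / 2, 1 / 2, by norm_num, by norm_num, by norm_num, by module⟩
  simpa using hx.2 hadd hsub hmid

theorem exists_pos_forall_mul_abs_le {α : Type*} {T : Set α} (hT : T.Finite)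
    {φ ψ : α → ℝ} (hφ : ∀ a ∈ T, 0 ≤ φ a) (h : ∀ a ∈ T, φ a = 0 → ψ a = 0) :
    ∃ ε > 0, ∀ a ∈ T, ε * |ψ a| ≤ φ a := by
  have key : ∀ᶠ ε : ℝ in nhdsWithin 0 (Set.Ioi 0), ∀ a ∈ T, ε * |ψ a| ≤ φ a := by
    refine (Filter.eventually_all_finite hT).2 fun a ha => ?_
    rcases (hφ a ha).eq_or_lt with h0 | hpos
    · simp [← h0, h a ha h0.symm]
    · have hlim : Filter.Tendsto (fun ε : ℝ => ε * |ψ a|) (nhdsWithin 0 (Set.Ioi 0)) (nhds 0) :=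
        tendsto_nhdsWithin_of_tendsto_nhds
          (by simpa using (continuous_id.mul_const |ψ a|).tendsto (0 : ℝ))
      exact (hlim.eventually_lt_const hpos).mono fun _ => le_of_lt
  obtain ⟨ε, hε, hpos⟩ := (key.and self_mem_nhdsWithin).exists
  exact ⟨ε, hpos, hε⟩

theorem homRank_eq_finrank_iff_bijective [FiniteDimensional ℝ E] [FiniteDimensional ℝ V]
    {P : Set E} (hP : affineSpan ℝ P = ⊤) (hdim : Module.finrank ℝ E = Module.finrank ℝ V)
    (f : E →ᵃ[ℝ] V) : homRank P f = Module.finrank ℝ V ↔ Function.Bijective f := by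
  have hspan : vectorSpan ℝ P = ⊤ := by
    rw [← direction_affineSpan, hP, AffineSubspace.direction_top]
  have hinj : Function.Injective f.linear ↔ Function.Surjective f.linear :=
    LinearMap.injective_iff_surjective_of_finrank_eq_finrank hdim
  rw [homRank, ← AffineMap.map_vectorSpan, hspan, Submodule.map_top,
    ← AffineMap.linear_bijective_iff, Function.Bijective, hinj, and_self,
    ← LinearMap.range_eq_top]
  exact ⟨Submodule.eq_top_of_finrank_eq, fun h => h ▸ finrank_top ℝ V⟩

/-- An affine function which is determined up to a scalar by its zeros in `S`. For a function that
is nonnegative on the vertices of a polytope and does not vanish identically, this says that it is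
the slack of a facet. -/
def IsFacetDefining (S : Set E) (g : E →ᵃ[ℝ] ℝ) : Prop :=
  ∀ g' : E →ᵃ[ℝ] ℝ, (∀ x ∈ S, g x = 0 → g' x = 0) → ∃ c : ℝ, g' = c • g

theorem mem_homPolytope_convexHull_iff [Finite ι] (b : AffineBasis ι ℝ V) {S : Set E}
    {f : E →ᵃ[ℝ] V} : f ∈ homPolytope (convexHull ℝ S) (convexHull ℝ (Set.range b)) ↔
      ∀ x ∈ S, ∀ i, 0 ≤ b.coord i (f x) := by
  change convexHull ℝ S ⊆ f ⁻¹' convexHull ℝ (Set.range b) ↔ _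
  rw [((convex_convexHull ℝ _).affine_preimage f).convexHull_subset_iff,
    b.convexHull_eq_nonneg_coord]
  rfl

variable [Fintype ι]

/-- The affine map whose coordinates with respect to the points `p i` are the affine functions
`g i`, provided that these sum to `1`. -/
def affineMapOfCoords (p : ι → V) (g : ι → E →ᵃ[ℝ] ℝ) : E →ᵃ[ℝ] V :=
  ∑ i, (LinearMap.toSpanSingleton ℝ V (p i)).toAffineMap.comp (g i)

theorem affineMapOfCoords_apply (p : ι → V) (g : ι → E →ᵃ[ℝ] ℝ) (x : E) :
    affineMapOfCoords p g x = ∑ i, g i x • p i := by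
  have hsum : ∀ s : Finset ι,
      (∑ i ∈ s, (LinearMap.toSpanSingleton ℝ V (p i)).toAffineMap.comp (g i)) x
        = ∑ i ∈ s, g i x • p i := fun s => by
    classical
    induction s using Finset.induction_on with
    | empty => simp
    | insert i s hi ih => simp [Finset.sum_insert hi, ih]
  exact hsum Finset.univ

variable (b : AffineBasis ι ℝ V)

theorem coord_sum_smul {w : ι → ℝ} (hw : ∑ j, w j = 1) (i : ι) :
    b.coord i (∑ j, w j • b j) = w i := by
  rw [← Finset.univ.affineCombination_eq_linear_combination b w hw]
  exact b.coord_apply_combination_of_mem (Finset.mem_univ i) hw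

theorem coord_add_sum_smul (v : V) {w : ι → ℝ} (hw : ∑ j, w j = 0) (i : ι) :
    b.coord i (v + ∑ j, w j • b j) = b.coord i v + w i := by
  have hcomb : v + ∑ j, w j • b j = ∑ j, (b.coord j v + w j) • b j := by
    simp_rw [add_smul, Finset.sum_add_distrib, b.linear_combination_coord_eq_self]
  rw [hcomb]
  exact coord_sum_smul b (by simp [Finset.sum_add_distrib, hw]) i

variable {S : Set E} {f : E →ᵃ[ℝ] V} {h : ι → E →ᵃ[ℝ] ℝ}

theorem coord_add_affineMapOfCoords_apply (hsum : ∀ x, ∑ i, h i x = 0) (i : ι) (x : E) :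
    b.coord i ((f + affineMapOfCoords b h) x) = b.coord i (f x) + h i x := by
  rw [AffineMap.coe_add, Pi.add_apply, affineMapOfCoords_apply, coord_add_sum_smul b _ (hsum x)]

theorem add_affineMapOfCoords_mem_homPolytope (hsum : ∀ x, ∑ i, h i x = 0)
    (hle : ∀ x ∈ S, ∀ i, |h i x| ≤ b.coord i (f x)) :
    f + affineMapOfCoords b h ∈ homPolytope (convexHull ℝ S) (convexHull ℝ (Set.range b)) := by
  refine (mem_homPolytope_convexHull_iff b).2 fun x hx i => ?_
  rw [coord_add_affineMapOfCoords_apply b hsum]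
  exact neg_le_iff_add_nonneg'.1 (neg_le_of_abs_le (hle x hx i))

theorem eq_zero_of_mem_extremePoints_homPolytope_of_abs_le
    (hf : f ∈ (homPolytope (convexHull ℝ S) (convexHull ℝ (Set.range b))).extremePoints ℝ)
    (hsum : ∀ x, ∑ i, h i x = 0) (hle : ∀ x ∈ S, ∀ i, |h i x| ≤ b.coord i (f x)) (i : ι) :
    h i = 0 := by
  have hneg : affineMapOfCoords b (-h) = -affineMapOfCoords b h := by
    ext x
    simp [affineMapOfCoords_apply]
  have hzero : affineMapOfCoords b h = 0 := by
    refine eq_zero_of_mem_extremePoints_of_add_mem_of_sub_mem hf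
      (add_affineMapOfCoords_mem_homPolytope b hsum hle) ?_
    rw [sub_eq_add_neg, ← hneg]
    exact add_affineMapOfCoords_mem_homPolytope b (by simpa using hsum) (by simpa using hle)
  ext x
  simpa [hzero] using coord_add_affineMapOfCoords_apply b (f := f) hsum i x

theorem mem_extremePoints_homPolytope_iff (hS : S.Finite) :
    f ∈ (homPolytope (convexHull ℝ S) (convexHull ℝ (Set.range b))).extremePoints ℝ ↔
      f ∈ homPolytope (convexHull ℝ S) (convexHull ℝ (Set.range b)) ∧
      ∀ h : ι → E →ᵃ[ℝ] ℝ, (∀ x, ∑ i, h i x = 0) →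
        (∀ i, ∀ x ∈ S, b.coord i (f x) = 0 → h i x = 0) → ∀ i, h i = 0 := by
  constructor
  · refine fun hf => ⟨hf.1, fun h hsum hzero i => ?_⟩
    have hnonneg := (mem_homPolytope_convexHull_iff b).1 hf.1
    -- A small multiple of `h` can be both added to the coordinates of `f` and subtracted from them.
    obtain ⟨ε, hε, hle⟩ := exists_pos_forall_mul_abs_le (hS.prod Set.finite_univ)
      (φ := fun q : E × ι => b.coord q.2 (f q.1)) (ψ := fun q => h q.2 q.1)
      (fun q hq => hnonneg q.1 hq.1 q.2) (fun q hq => hzero q.2 q.1 hq.1)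
    have hsmul : ε • h i = 0 :=
      eq_zero_of_mem_extremePoints_homPolytope_of_abs_le b hf (h := ε • h)
        (fun x => by simp [← Finset.mul_sum, hsum x])
        (fun x hx j => by simpa [abs_mul, abs_of_pos hε] using hle (x, j) ⟨hx, Set.mem_univ j⟩) i
    exact (smul_eq_zero.1 hsmul).resolve_left hε.ne'
  · rintro ⟨hmem, hrigid⟩
    refine mem_extremePoints_iff_left.2 ⟨hmem, ?_⟩
    rintro f₁ hf₁ f₂ hf₂ ⟨s, t, hs, ht, hst, rfl⟩
    rw [mem_homPolytope_convexHull_iff] at hf₁ hf₂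
    have hdiff := hrigid (fun i => (b.coord i).comp f₁ - (b.coord i).comp (s • f₁ + t • f₂))
      (fun x => by simp [-AffineMap.coe_add, -AffineMap.coe_smul]) fun i x hx hzero => by
        have hsplit : s * b.coord i (f₁ x) + t * b.coord i (f₂ x) = 0 := by
          rw [← hzero]
          exact (Convex.combo_affine_apply hst).symm
        have hfst := ((add_eq_zero_iff_of_nonneg (mul_nonneg hs.le (hf₁ x hx i))
          (mul_nonneg ht.le (hf₂ x hx i))).1 hsplit).1
        rw [AffineMap.coe_sub, Pi.sub_apply, AffineMap.comp_apply, AffineMap.comp_apply, hzero,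
          sub_zero, (mul_eq_zero.1 hfst).resolve_left hs.ne']
    ext x
    exact b.ext_elem fun i => sub_eq_zero.1 (DFunLike.congr_fun (hdiff i) x)

theorem affineMap_apply_eq_sum_coord_mul (φ : V →ᵃ[ℝ] ℝ) (v : V) :
    φ v = ∑ i, b.coord i v * φ (b i) := by
  conv_lhs => rw [← b.affineCombination_coord_eq_self v]
  rw [Finset.univ.map_affineCombination b _ (b.sum_coord_apply_eq_one v),
    Finset.affineCombination_eq_linear_combination _ _ _ (b.sum_coord_apply_eq_one v)]
  rfl

omit [Fintype ι] in
theorem mem_extremePoints_homPolytope_iff_isFacetDefining [Finite ι] (hS : S.Finite)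
    (hbij : Function.Bijective f) :
    f ∈ (homPolytope (convexHull ℝ S) (convexHull ℝ (Set.range b))).extremePoints ℝ ↔
      f ∈ homPolytope (convexHull ℝ S) (convexHull ℝ (Set.range b)) ∧
      ∀ i, IsFacetDefining S ((b.coord i).comp f) := by
  classical
  have := Fintype.ofFinite ι
  obtain ⟨e, rfl⟩ : ∃ e : E ≃ᵃ[ℝ] V, ↑e = f := ⟨AffineEquiv.ofBijective hbij, rfl⟩
  rw [mem_extremePoints_homPolytope_iff b hS]
  refine and_congr_right fun _ => ⟨fun hrigid i g hg => ?_, fun hfacet h hsum hzero i => ?_⟩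
  · -- As `f` is invertible, `g` is a combination of the coordinates of `f`; subtracting `g` from
    -- its `i`-th term gives functions with sum zero, to which rigidity applies.
    let c : ι → ℝ := fun j => g (e.symm (b j))
    have hexpand : ∀ x, g x = ∑ j, c j * b.coord j (e x) := fun x => by
      simpa [c, mul_comm] using
        affineMap_apply_eq_sum_coord_mul b (g.comp (e.symm : V →ᵃ[ℝ] E)) (e x)
    refine ⟨c i, ?_⟩
    have hzero := hrigid
      (fun j => c j • (b.coord j).comp (e : E →ᵃ[ℝ] V) - if j = i then g else 0)
      (fun x => by simp [hexpand, apply_ite (fun φ : E →ᵃ[ℝ] ℝ => φ x)])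
      (fun j x hx hj => by
        have hj' : b.coord j (e x) = 0 := hj
        rcases eq_or_ne j i with rfl | hji
        · simp [hj', hg x hx hj]
        · simp [hj', hji]) i
    rw [if_pos rfl, sub_eq_zero] at hzero
    exact hzero.symm
  · -- At the point which `f` sends to the vertex `b i`, only the `i`-th summand of `h` survives.
    choose c hc using fun j => hfacet j (h j) (hzero j)
    have hci : c i = 0 := by
      simpa [hc, b.coord_apply] using hsum (e.symm (b i))
    rw [hc, hci, zero_smul]

end HomSimplex

/-! ### Affine functions on the plane -/

section Slack

variable {F : Type*} [NormedAddCommGroup F] [InnerProductSpace ℝ F]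

/-- The distance to the line `⟪u, ·⟫ = δ`, measured against the direction of the outer normal `u`
and scaled by `‖u‖`. -/
noncomputable def slack (δ : ℝ) (u : F) : F →ᵃ[ℝ] ℝ :=
  AffineMap.const ℝ F δ - (innerₗ F u).toAffineMap

@[simp]
theorem slack_apply (δ : ℝ) (u z : F) : slack δ u z = δ - ⟪u, z⟫_ℝ := rfl

theorem sum_mul_slack_apply {ι : Type*} [Fintype ι] (c : ι → ℝ) (δ : ℝ) (u : ι → F) (z : F) :
    ∑ i, c i * slack δ (u i) z = (∑ i, c i) * δ - ⟪∑ i, c i • u i, z⟫_ℝ := by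
  simp only [slack_apply, mul_sub, Finset.sum_sub_distrib, Finset.sum_mul, sum_inner,
    real_inner_smul_left]

end Slack

section Plane

theorem complex_real_inner_eq (w z : ℂ) : ⟪w, z⟫_ℝ = w.re * z.re + w.im * z.im := by
  rw [Complex.inner, Complex.mul_re, Complex.conj_re, Complex.conj_im]
  ring

/-- The oriented area of the parallelogram spanned by `u` and `v`. -/
def cross (u v : ℂ) : ℝ := (conj u * v).im

theorem cross_eq (u v : ℂ) : cross u v = u.re * v.im - u.im * v.re := by
  simp only [cross, Complex.mul_im, Complex.conj_re, Complex.conj_im]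
  ring

/-- The `2 × 2` minors of the matrix with columns `u 0, u 1, u 2`, with the signs of a cross product
of its rows. -/
def minor (u : Fin 3 → ℂ) (m : Fin 3) : ℝ := cross (u (m + 1)) (u (m + 2))

variable {u : Fin 3 → ℂ}

theorem sum_minor_smul_eq_zero (u : Fin 3 → ℂ) : ∑ m, minor u m • u m = 0 := by
  apply Complex.ext <;> simp [Fin.sum_univ_three, minor, cross_eq] <;> ring

theorem mul_minor_eq_mul_minor {c : Fin 3 → ℝ} (hdep : ∑ m, c m • u m = 0) (l m : Fin 3) :
    c l * minor u m = c m * minor u l := by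
  have hre := congrArg Complex.re hdep
  have him := congrArg Complex.im hdep
  simp only [Fin.sum_univ_three, Complex.add_re, Complex.add_im, Complex.smul_re, Complex.smul_im,
    smul_eq_mul, Complex.zero_re, Complex.zero_im] at hre him
  fin_cases l <;> fin_cases m <;> simp [minor, cross_eq] <;> grind

theorem exists_minor_ne_zero (hu : ∀ z, (∀ m, ⟪u m, z⟫_ℝ = 0) → z = 0) : ∃ m, minor u m ≠ 0 := by
  by_contra! hminor
  have hcross : ∀ m k, ⟪u m, Complex.I * u k⟫_ℝ = 0 := fun m k => by
    have h0 := hminor 0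
    have h1 := hminor 1
    have h2 := hminor 2
    simp only [minor, cross_eq] at h0 h1 h2
    rw [complex_real_inner_eq]
    fin_cases m <;> fin_cases k <;> simp at * <;> linarith
  have hzero : ∀ k, u k = 0 := fun k => by simpa using hu _ fun m => hcross m k
  exact one_ne_zero (hu 1 fun m => by rw [hzero m, inner_zero_left])

theorem exists_minor_eq_mul {c : Fin 3 → ℝ} (hc : ∀ m, c m ≠ 0) (hdep : ∑ m, c m • u m = 0)
    (hu : ∀ z, (∀ m, ⟪u m, z⟫_ℝ = 0) → z = 0) : ∃ r ≠ 0, ∀ m, minor u m = c m * r := by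
  obtain ⟨l, hl⟩ := exists_minor_ne_zero hu
  refine ⟨minor u l / c l, div_ne_zero hl (hc l), fun m => ?_⟩
  rw [mul_div_assoc', eq_div_iff (hc l), mul_comm, mul_minor_eq_mul_minor hdep]

theorem eq_zero_of_inner_eq_zero {v w z : ℂ} (hvw : cross v w ≠ 0) (hv : ⟪v, z⟫_ℝ = 0)
    (hw : ⟪w, z⟫_ℝ = 0) : z = 0 := by
  rw [complex_real_inner_eq] at hv hw
  rw [cross_eq] at hvw
  have hre : (v.re * w.im - v.im * w.re) * z.re = 0 := by
    linear_combination w.im * hv - v.im * hw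
  have him : (v.re * w.im - v.im * w.re) * z.im = 0 := by
    linear_combination v.re * hw - w.re * hv
  exact Complex.ext ((mul_eq_zero.1 hre).resolve_left hvw) ((mul_eq_zero.1 him).resolve_left hvw)

theorem affineMap_apply_eq_of_two_zeros {g : ℂ →ᵃ[ℝ] ℝ} {p q : ℂ} (hpq : p ≠ q) (hp : g p = 0)
    (hq : g q = 0) (z : ℂ) :
    g z = ((z - p) / (q - p)).im * g.linear (Complex.I * (q - p)) := by
  have hlin : g.linear (q - p) = 0 := by rw [← vsub_eq_sub, g.linearMap_vsub, hp, hq, vsub_self]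
  have hz : z = (((z - p) / (q - p)).re • (q - p) +
      ((z - p) / (q - p)).im • (Complex.I * (q - p))) +ᵥ p := by
    have hdecomp := Complex.re_add_im ((z - p) / (q - p))
    rw [eq_div_iff (sub_ne_zero.2 hpq.symm)] at hdecomp
    rw [vadd_eq_add, Complex.real_smul, Complex.real_smul]
    linear_combination -hdecomp
  conv_lhs => rw [hz, g.map_vadd, hp, map_add, map_smul, map_smul, hlin]
  simp only [smul_eq_mul, mul_zero, zero_add, vadd_eq_add, add_zero]

theorem exists_eq_smul_of_two_zeros {g g' : ℂ →ᵃ[ℝ] ℝ} (hg : g ≠ 0) {p q : ℂ} (hpq : p ≠ q)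
    (hp : g p = 0) (hq : g q = 0) (hp' : g' p = 0) (hq' : g' q = 0) : ∃ c : ℝ, g' = c • g := by
  have happly := affineMap_apply_eq_of_two_zeros hpq hp hq
  have hne : g.linear (Complex.I * (q - p)) ≠ 0 := fun h0 =>
    hg (by ext z; simp only [happly, h0, mul_zero, AffineMap.coe_zero, Pi.zero_apply])
  refine ⟨g'.linear (Complex.I * (q - p)) / g.linear (Complex.I * (q - p)), ?_⟩
  ext z
  rw [AffineMap.coe_smul, Pi.smul_apply, smul_eq_mul, happly,
    affineMap_apply_eq_of_two_zeros hpq hp' hq']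
  field

theorem isFacetDefining_iff_nontrivial {S : Set ℂ} {g : ℂ →ᵃ[ℝ] ℝ} (hg : g ≠ 0) :
    IsFacetDefining S g ↔ {x ∈ S | g x = 0}.Nontrivial := by
  constructor
  · intro hfacet
    by_contra hsub
    obtain ⟨a, ha⟩ : ∃ a, ∀ x ∈ S, g x = 0 → x = a := by
      rcases (Set.not_nontrivial_iff.1 hsub).eq_empty_or_singleton with h | ⟨a, h⟩
      · exact ⟨0, fun x hx h0 => (h.subset ⟨hx, h0⟩).elim⟩
      · exact ⟨a, fun x hx h0 => h.subset ⟨hx, h0⟩⟩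
    -- Both `re - a.re` and `im - a.im` vanish at `a`, but they are not proportional.
    obtain ⟨c, hc⟩ := hfacet (Complex.reLm.toAffineMap - AffineMap.const ℝ ℂ a.re) fun x hx h0 => by
      simp [ha x hx h0]
    obtain ⟨c', hc'⟩ := hfacet (Complex.imLm.toAffineMap - AffineMap.const ℝ ℂ a.im)
      fun x hx h0 => by simp [ha x hx h0]
    have hre : 1 = c * g (a + 1) := by simpa using DFunLike.congr_fun hc (a + 1)
    have him : 0 = c' * g (a + 1) := by simpa using DFunLike.congr_fun hc' (a + 1)
    have hI : 1 = c' * g (a + Complex.I) := by simpa using DFunLike.congr_fun hc' (a + Complex.I)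
    rcases mul_eq_zero.1 him.symm with h | h <;> simp [h] at hre hI
  · rintro ⟨p, ⟨hpS, hp⟩, q, ⟨hqS, hq⟩, hpq⟩ g' hg'
    exact exists_eq_smul_of_two_zeros hg hpq hp hq (hg' p hpS hp) (hg' q hqS hq)

end Plane

/-! ### Triangles circumscribed about a circle -/

section Circumscribed

/-- The three vectors `u m` are the outer normals of a triangle: some combination of them with
positive coefficients vanishes and they span the plane. By Cramer's rule this means that the minors
of `u` are nonzero and have the same sign, which is the orientation of `u`. -/
def IsBalanced (u : Fin 3 → ℂ) : Prop :=
  (∀ m, 0 < minor u m) ∨ ∀ m, minor u m < 0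

/-- The coefficients of the three slacks `slack δ (u m)` in their affine dependence with sum `1`. -/
noncomputable def slackWeight (δ : ℝ) (u : Fin 3 → ℂ) (m : Fin 3) : ℝ :=
  minor u m / ((∑ l, minor u l) * δ)

variable {u : Fin 3 → ℂ} {δ : ℝ}

theorem IsBalanced.slackWeight_pos (hu : IsBalanced u) (hδ : 0 < δ) (m : Fin 3) :
    0 < slackWeight δ u m := by
  rw [slackWeight, ← div_div]
  refine div_pos ?_ hδ
  rcases hu with hu | hu
  · exact div_pos (hu m) (Finset.sum_pos (fun l _ => hu l) Finset.univ_nonempty)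
  · exact div_pos_of_neg_of_neg (hu m) (Finset.sum_neg (fun l _ => hu l) Finset.univ_nonempty)

theorem IsBalanced.sum_minor_ne_zero (hu : IsBalanced u) : ∑ m, minor u m ≠ 0 := by
  rcases hu with hu | hu
  · exact (Finset.sum_pos (fun l _ => hu l) Finset.univ_nonempty).ne'
  · exact (Finset.sum_neg (fun l _ => hu l) Finset.univ_nonempty).ne

theorem IsBalanced.sum_slackWeight_mul_slack (hu : IsBalanced u) (hδ : δ ≠ 0) (z : ℂ) :
    ∑ m, slackWeight δ u m * slack δ (u m) z = 1 := by
  have hsum : ∑ m, slackWeight δ u m • u m = 0 := by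
    simp only [slackWeight, div_eq_inv_mul, mul_smul, ← Finset.smul_sum, sum_minor_smul_eq_zero,
      smul_zero]
  have hne := hu.sum_minor_ne_zero
  rw [sum_mul_slack_apply, hsum, inner_zero_left, sub_zero]
  simp only [slackWeight, ← Finset.sum_div]
  field

variable {V : Type*} [AddCommGroup V] [Module ℝ V] (b : AffineBasis (Fin 3) ℝ V)

/-- For balanced normals `u`, the affine map sending the triangle cut out by the inequalities
`⟪u m, z⟫ ≤ δ` onto the triangle `p`, its `m`-th edge going to the edge opposite to `p m`. -/
noncomputable def circumMap (p : Fin 3 → V) (δ : ℝ) (u : Fin 3 → ℂ) : ℂ →ᵃ[ℝ] V :=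
  affineMapOfCoords p fun m => slackWeight δ u m • slack δ (u m)

theorem IsBalanced.coord_comp_circumMap (hu : IsBalanced u) (hδ : δ ≠ 0) (m : Fin 3) :
    (b.coord m).comp (circumMap b δ u) = slackWeight δ u m • slack δ (u m) := by
  ext z
  rw [AffineMap.comp_apply, circumMap, affineMapOfCoords_apply]
  exact coord_sum_smul b (hu.sum_slackWeight_mul_slack hδ z) m

theorem IsBalanced.circumMap_injective (hu : IsBalanced u) (hδ : 0 < δ) :
    Function.Injective (circumMap b δ u) := by
  intro z w hzw
  have hinner : ∀ m, ⟪u m, z - w⟫_ℝ = 0 := fun m => by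
    have hcoord : ∀ x, b.coord m (circumMap b δ u x) = slackWeight δ u m * (δ - ⟪u m, x⟫_ℝ) :=
      fun x => DFunLike.congr_fun (hu.coord_comp_circumMap b hδ.ne' m) x
    have heq := congrArg (b.coord m) hzw
    rw [hcoord, hcoord, mul_right_inj' (hu.slackWeight_pos hδ m).ne'] at heq
    rw [inner_sub_right]
    linarith
  have hcross : cross (u 1) (u 2) ≠ 0 := by
    rcases hu with hu | hu
    · exact (hu 0).ne'
    · exact (hu 0).ne
  exact sub_eq_zero.1 (eq_zero_of_inner_eq_zero hcross (hinner 1) (hinner 2))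

include b in
theorem finrank_eq_two_of_affineBasis : Module.finrank ℝ V = 2 := by
  simpa using b.card_eq_finrank_add_one.symm

theorem IsBalanced.circumMap_bijective (hu : IsBalanced u) (hδ : 0 < δ) :
    Function.Bijective (circumMap b δ u) := by
  have : FiniteDimensional ℝ V := b.finiteDimensional
  have hlinear := (circumMap b δ u).linear_injective_iff.2 (hu.circumMap_injective b hδ)
  have hdim : Module.finrank ℝ ℂ = Module.finrank ℝ V := by
    rw [Complex.finrank_real_complex, finrank_eq_two_of_affineBasis b]
  exact (circumMap b δ u).linear_bijective_iff.1
    ⟨hlinear, (LinearMap.injective_iff_surjective_of_finrank_eq_finrank hdim).1 hlinear⟩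

theorem isBalanced_and_eq_circumMap {f : ℂ →ᵃ[ℝ] V} (hf : Function.Injective f) {c : Fin 3 → ℝ}
    (hc : ∀ m, 0 < c m) (hcoord : ∀ m, (b.coord m).comp f = c m • slack δ (u m)) :
    IsBalanced u ∧ f = circumMap b δ u := by
  have hcoord' : ∀ m z, b.coord m (f z) = c m * slack δ (u m) z := fun m z =>
    DFunLike.congr_fun (hcoord m) z
  have hone : ∀ z, (∑ m, c m) * δ - ⟪∑ m, c m • u m, z⟫_ℝ = 1 := fun z => by
    rw [← sum_mul_slack_apply, ← b.sum_coord_apply_eq_one (f z)]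
    simp only [hcoord']
  have hsum : (∑ m, c m) * δ = 1 := by simpa using hone 0
  have hdep : ∑ m, c m • u m = 0 := by
    simpa [hsum] using hone (∑ m, c m • u m)
  obtain ⟨r, hr, hminor⟩ := exists_minor_eq_mul (fun m => (hc m).ne') hdep fun z hz =>
    hf (b.ext_elem fun m => by simp [hcoord', hz])
  have hu : IsBalanced u := by
    simp only [IsBalanced, hminor]
    exact hr.lt_or_gt.symm.imp (fun hr m => mul_pos (hc m) hr)
      fun hr m => mul_neg_of_pos_of_neg (hc m) hr
  refine ⟨hu, ?_⟩
  have hδ : δ ≠ 0 := right_ne_zero_of_mul_eq_one hsum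
  have hweight : ∀ m, c m = slackWeight δ u m := fun m => by
    have hne := hu.sum_minor_ne_zero
    rw [slackWeight, eq_div_iff (mul_ne_zero hne hδ)]
    simp only [hminor, ← Finset.sum_mul]
    linear_combination (c m * r) * hsum
  ext z
  refine b.ext_elem fun m => ?_
  rw [hcoord', hweight]
  exact (DFunLike.congr_fun (hu.coord_comp_circumMap b hδ m) z).symm

end Circumscribed

/-! ### Edges of the regular polygon -/

section RegularPolygon

variable {n : ℕ} [NeZero n]

theorem stdAddChar_natCast (m : ℕ) :
    stdAddChar (m : ZMod n) = Complex.exp ((2 * Real.pi * m / n : ℝ) * Complex.I) := by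
  have := ZMod.stdAddChar_coe (N := n) (m : ℤ)
  push_cast at this ⊢
  rw [this]
  ring_nf

theorem zeta_pow_eq_stdAddChar (k : ℕ) : zeta n ^ k = stdAddChar (k : ZMod n) := by
  have hzeta : zeta n = stdAddChar (1 : ZMod n) := by
    rw [← Nat.cast_one, stdAddChar_natCast, Nat.cast_one, mul_one]
    apply Complex.ext
    · rw [Complex.exp_ofReal_mul_I_re, zeta]
    · rw [Complex.exp_ofReal_mul_I_im, zeta]
  rw [hzeta, ← AddChar.map_nsmul_eq_pow, nsmul_one]

theorem regularPolygon_eq_convexHull_range_stdAddChar :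
    regularPolygon n = convexHull ℝ (Set.range (stdAddChar : ZMod n → ℂ)) := by
  rw [regularPolygon]
  congr 1
  apply Set.Subset.antisymm
  · rintro _ ⟨k, rfl⟩
    exact ⟨_, (zeta_pow_eq_stdAddChar _).symm⟩
  · rintro _ ⟨k, rfl⟩
    exact ⟨⟨k.val, k.val_lt⟩, by simp only [zeta_pow_eq_stdAddChar, ZMod.natCast_zmod_val]⟩

/-- The outer unit normal of the edge of the regular `n`-gon between its `j`-th and `j + 1`-st
vertices. -/
noncomputable def edgeNormal (n : ℕ) [NeZero n] (j : ZMod n) : ℂ :=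
  Complex.exp ((Real.pi / n : ℝ) * Complex.I) * stdAddChar j

/-- The distance to the line through the `j`-th edge of the regular `n`-gon, which is itself at
distance `cos (π / n)` from the centre. -/
noncomputable def edgeSlack (n : ℕ) [NeZero n] (j : ZMod n) : ℂ →ᵃ[ℝ] ℝ :=
  slack (Real.cos (Real.pi / n)) (edgeNormal n j)

theorem conj_stdAddChar_mul_stdAddChar (i j : ZMod n) :
    conj (stdAddChar i) * stdAddChar j = stdAddChar (j - i) := by
  rw [← AddChar.map_neg_eq_conj, ← AddChar.map_add_eq_mul, neg_add_eq_sub]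

theorem conj_exp_mul_exp_ofReal_mul_I (x y : ℝ) :
    conj (Complex.exp (x * Complex.I)) * Complex.exp (y * Complex.I) =
      Complex.exp ((y - x : ℝ) * Complex.I) := by
  rw [← Complex.exp_conj, map_mul, Complex.conj_ofReal, Complex.conj_I, ← Complex.exp_add]
  push_cast
  ring_nf

theorem edgeSlack_stdAddChar_add_natCast (j : ZMod n) (m : ℕ) :
    edgeSlack n j (stdAddChar (j + (m : ZMod n))) =
      2 * Real.sin (m * Real.pi / n) * Real.sin ((m - 1) * Real.pi / n) := by
  have hinner : ⟪edgeNormal n j, stdAddChar (j + (m : ZMod n))⟫_ℝ =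
      Real.cos (2 * Real.pi * m / n - Real.pi / n) := by
    rw [Complex.inner, edgeNormal, map_mul, mul_comm, mul_assoc, conj_stdAddChar_mul_stdAddChar,
      add_sub_cancel_left, stdAddChar_natCast, conj_exp_mul_exp_ofReal_mul_I,
      Complex.exp_ofReal_mul_I_re]
  have hhalf : (Real.pi / n - (2 * Real.pi * m / n - Real.pi / n)) / 2 =
      -((m - 1) * Real.pi / n) := by ring
  have hhalf' : (Real.pi / n + (2 * Real.pi * m / n - Real.pi / n)) / 2 = m * Real.pi / n := by
    ring
  rw [edgeSlack, slack_apply, hinner, Real.cos_sub_cos, hhalf, hhalf', Real.sin_neg]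
  ring

theorem edgeSlack_stdAddChar_self (j : ZMod n) : edgeSlack n j (stdAddChar j) = 0 := by
  simpa using edgeSlack_stdAddChar_add_natCast j 0

theorem edgeSlack_stdAddChar_add_one (j : ZMod n) : edgeSlack n j (stdAddChar (j + 1)) = 0 := by
  simpa using edgeSlack_stdAddChar_add_natCast j 1

theorem edgeSlack_stdAddChar_pos {j k : ZMod n} (hj : k ≠ j) (hj' : k ≠ j + 1) :
    0 < edgeSlack n j (stdAddChar k) := by
  have hk : k = j + ((k - j).val : ZMod n) := by simp
  have hn : (0 : ℝ) < n := Nat.cast_pos.2 (NeZero.pos n)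
  have hone : (1 : ℝ) < (k - j).val := by
    have h0 : (k - j).val ≠ 0 := fun h => hj (by simpa [h] using hk)
    have h1 : (k - j).val ≠ 1 := fun h => hj' (by simpa [h] using hk)
    exact_mod_cast (show 1 < (k - j).val by omega)
  have hlt : ((k - j).val : ℝ) < n := Nat.cast_lt.2 (k - j).val_lt
  have hsin : ∀ x : ℝ, 0 < x → x < n → 0 < Real.sin (x * Real.pi / n) := fun x hx hxn =>
    Real.sin_pos_of_pos_of_lt_pi (by positivity)
      (by rw [div_lt_iff₀ hn, mul_comm]; gcongr)
  rw [hk, edgeSlack_stdAddChar_add_natCast]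
  exact mul_pos (mul_pos two_pos (hsin _ (by linarith) hlt)) (hsin _ (by linarith) (by linarith))

theorem edgeSlack_stdAddChar_nonneg (j k : ZMod n) : 0 ≤ edgeSlack n j (stdAddChar k) := by
  rcases eq_or_ne k j with rfl | hj
  · exact (edgeSlack_stdAddChar_self k).ge
  · rcases eq_or_ne k (j + 1) with rfl | hj'
    · exact (edgeSlack_stdAddChar_add_one j).ge
    · exact (edgeSlack_stdAddChar_pos hj hj').le

theorem eq_or_eq_add_one_of_edgeSlack_eq_zero {j k : ZMod n}
    (h : edgeSlack n j (stdAddChar k) = 0) : k = j ∨ k = j + 1 := by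
  contrapose! h
  exact (edgeSlack_stdAddChar_pos h.1 h.2).ne'

omit [NeZero n] in
theorem two_ne_zero_of_three_le (hn : 3 ≤ n) : (2 : ZMod n) ≠ 0 := by
  have := (ZMod.natCast_eq_zero_iff 2 n).not.2 fun h => by
    have := Nat.le_of_dvd two_pos h
    omega
  exact_mod_cast this

theorem edgeSlack_ne_zero (hn : 3 ≤ n) (j : ZMod n) : edgeSlack n j ≠ 0 := fun h => by
  have h2 := two_ne_zero_of_three_le hn
  have hpos : 0 < edgeSlack n j (stdAddChar (j + 2)) :=
    edgeSlack_stdAddChar_pos (fun h => h2 (by linear_combination h))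
      (fun h => h2 (by linear_combination 2 * h))
  simp [h] at hpos

theorem eq_of_smul_edgeSlack_eq_smul_edgeSlack (hn : 3 ≤ n) {i j : ZMod n} {c c' : ℝ}
    (hc' : c' ≠ 0) (h : c • edgeSlack n i = c' • edgeSlack n j) : i = j := by
  have hzero : ∀ k : ZMod n, edgeSlack n i (stdAddChar k) = 0 → k = j ∨ k = j + 1 := fun k hk => by
    have happly := DFunLike.congr_fun h (stdAddChar k)
    rw [AffineMap.coe_smul, AffineMap.coe_smul, Pi.smul_apply, Pi.smul_apply, hk, smul_zero,
      eq_comm, smul_eq_zero] at happly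
    exact eq_or_eq_add_one_of_edgeSlack_eq_zero (happly.resolve_left hc')
  have hi := hzero i (edgeSlack_stdAddChar_self i)
  have hi' := hzero (i + 1) (edgeSlack_stdAddChar_add_one i)
  have h2 := two_ne_zero_of_three_le hn
  grind

theorem exists_eq_smul_edgeSlack_add_smul_edgeSlack (hn : 3 ≤ n) {g : ℂ →ᵃ[ℝ] ℝ}
    (hg : ∀ k : ZMod n, 0 ≤ g (stdAddChar k)) {a : ZMod n} (ha : g (stdAddChar a) = 0) :
    ∃ α β : ℝ, 0 ≤ α ∧ 0 ≤ β ∧ g = α • edgeSlack n a + β • edgeSlack n (a - 1) := by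
  have h2 := two_ne_zero_of_three_le hn
  have hpred : a - 1 ≠ a := fun h => h2 (by linear_combination -2 * h)
  have hpos : 0 < edgeSlack n a (stdAddChar (a - 1)) :=
    edgeSlack_stdAddChar_pos hpred (fun h => h2 (by linear_combination -h))
  have hpos' : 0 < edgeSlack n (a - 1) (stdAddChar (a + 1)) :=
    edgeSlack_stdAddChar_pos (fun h => h2 (by linear_combination h))
      (fun h => h2 (by linear_combination 2 * h))
  have hzero := edgeSlack_stdAddChar_add_one (a - 1)
  rw [sub_add_cancel] at hzero
  obtain ⟨α, hα, hαeq⟩ : ∃ α : ℝ, 0 ≤ α ∧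
      g (stdAddChar (a - 1)) = α * edgeSlack n a (stdAddChar (a - 1)) :=
    ⟨g (stdAddChar (a - 1)) / edgeSlack n a (stdAddChar (a - 1)),
      div_nonneg (hg _) hpos.le, by rw [div_mul_cancel₀ _ hpos.ne']⟩
  have hrest : ∀ z, (g - α • edgeSlack n a) z = g z - α * edgeSlack n a z := fun z => rfl
  obtain ⟨β, hβ⟩ : ∃ β : ℝ, g - α • edgeSlack n a = β • edgeSlack n (a - 1) :=
    exists_eq_smul_of_two_zeros (edgeSlack_ne_zero hn (a - 1))
      (ZMod.injective_stdAddChar.ne hpred) (edgeSlack_stdAddChar_self (a - 1)) hzero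
      (by rw [hrest, hαeq, sub_self])
      (by rw [hrest, ha, edgeSlack_stdAddChar_self, mul_zero, sub_zero])
  refine ⟨α, β, hα, ?_, by rw [← hβ, add_sub_cancel]⟩
  have happly : g (stdAddChar (a + 1)) = β * edgeSlack n (a - 1) (stdAddChar (a + 1)) := by
    have := DFunLike.congr_fun hβ (stdAddChar (a + 1))
    rwa [hrest, edgeSlack_stdAddChar_add_one, mul_zero, sub_zero] at this
  exact nonneg_of_mul_nonneg_left (happly ▸ hg (a + 1)) hpos'

theorem exists_eq_smul_edgeSlack_of_two_zeros (hn : 3 ≤ n) {g : ℂ →ᵃ[ℝ] ℝ}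
    (hg : ∀ k : ZMod n, 0 ≤ g (stdAddChar k)) {a k : ZMod n} (hak : a ≠ k)
    (ha : g (stdAddChar a) = 0) (hk : g (stdAddChar k) = 0) :
    ∃ j, ∃ c : ℝ, 0 ≤ c ∧ g = c • edgeSlack n j := by
  obtain ⟨α, β, hα, hβ, rfl⟩ := exists_eq_smul_edgeSlack_add_smul_edgeSlack hn hg ha
  have hsum : α * edgeSlack n a (stdAddChar k) + β * edgeSlack n (a - 1) (stdAddChar k) = 0 := hk
  obtain ⟨hαk, hβk⟩ := (add_eq_zero_iff_of_nonneg
    (mul_nonneg hα (edgeSlack_stdAddChar_nonneg _ _))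
    (mul_nonneg hβ (edgeSlack_stdAddChar_nonneg _ _))).1 hsum
  rcases mul_eq_zero.1 hαk with rfl | hk₁
  · exact ⟨a - 1, β, hβ, by rw [zero_smul, zero_add]⟩
  · rcases mul_eq_zero.1 hβk with rfl | hk₂
    · exact ⟨a, α, hα, by rw [zero_smul, add_zero]⟩
    · have hsucc : k = a + 1 :=
        (eq_or_eq_add_one_of_edgeSlack_eq_zero hk₁).resolve_left hak.symm
      have hpred : k = a - 1 := (eq_or_eq_add_one_of_edgeSlack_eq_zero hk₂).resolve_right
        fun h => hak (by rw [h, sub_add_cancel])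
      exact absurd (by linear_combination hpred - hsucc) (two_ne_zero_of_three_le hn)

theorem isFacetDefining_range_stdAddChar_iff (hn : 3 ≤ n) {g : ℂ →ᵃ[ℝ] ℝ}
    (hg : ∀ k : ZMod n, 0 ≤ g (stdAddChar k)) (hne : g ≠ 0) :
    IsFacetDefining (Set.range (stdAddChar : ZMod n → ℂ)) g ↔
      ∃ j, ∃ c : ℝ, 0 < c ∧ g = c • edgeSlack n j := by
  rw [isFacetDefining_iff_nontrivial hne]
  constructor
  · rintro ⟨_, ⟨⟨a, rfl⟩, ha⟩, _, ⟨⟨k, rfl⟩, hk⟩, hak⟩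
    obtain ⟨j, c, hc, rfl⟩ :=
      exists_eq_smul_edgeSlack_of_two_zeros hn hg (ne_of_apply_ne _ hak) ha hk
    exact ⟨j, c, hc.lt_of_ne fun h => hne (by rw [← h, zero_smul]), rfl⟩
  · rintro ⟨j, c, -, rfl⟩
    have h2 := two_ne_zero_of_three_le hn
    exact ⟨stdAddChar j, ⟨⟨j, rfl⟩, by simp [edgeSlack_stdAddChar_self]⟩,
      stdAddChar (j + 1), ⟨⟨j + 1, rfl⟩, by simp [edgeSlack_stdAddChar_add_one]⟩,
      ZMod.injective_stdAddChar.ne fun h => h2 (by linear_combination -2 * h)⟩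

end RegularPolygon

/-! ### Counting acute triangles -/

section Counting

variable {n : ℕ}

/-- Going from a vertex of the regular `n`-gon to the `d`-th next one counterclockwise covers less
than half of the circle. -/
def IsShortArc (d : ZMod n) : Prop :=
  0 < d.val ∧ 2 * d.val < n

instance : DecidablePred (IsShortArc (n := n)) := fun d =>
  inferInstanceAs (Decidable (0 < d.val ∧ 2 * d.val < n))

variable [NeZero n]

theorem stdAddChar_im_pos_iff (d : ZMod n) : 0 < (stdAddChar d).im ↔ IsShortArc d := by
  have hn : (0 : ℝ) < n := Nat.cast_pos.2 (NeZero.pos n)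
  have hpi := Real.pi_pos
  have him : (stdAddChar d).im = Real.sin (2 * Real.pi * d.val / n) := by
    conv_lhs => rw [← ZMod.natCast_zmod_val d, stdAddChar_natCast, Complex.exp_ofReal_mul_I_im]
  rw [him, IsShortArc]
  constructor
  · refine fun h => ⟨Nat.pos_of_ne_zero fun h0 => by simp [h0] at h, ?_⟩
    by_contra! hlong
    have hlong' : (n : ℝ) ≤ 2 * d.val := by exact_mod_cast hlong
    have hpi_le : Real.pi ≤ 2 * Real.pi * d.val / n := by
      rw [le_div_iff₀ hn]
      nlinarith
    have hle_two_pi : 2 * Real.pi * d.val / n ≤ 2 * Real.pi := by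
      rw [div_le_iff₀ hn]
      gcongr
      exact d.val_lt.le
    rw [← Real.sin_sub_two_pi] at h
    exact h.not_ge (Real.sin_nonpos_of_nonpos_of_neg_pi_le (by linarith) (by linarith))
  · rintro ⟨hpos, hshort⟩
    have hshort' : (2 * d.val : ℝ) < n := by exact_mod_cast hshort
    refine Real.sin_pos_of_pos_of_lt_pi (by positivity) ?_
    rw [div_lt_iff₀ hn]
    nlinarith

theorem stdAddChar_neg_im (d : ZMod n) : (stdAddChar (-d)).im = -(stdAddChar d).im := by
  rw [AddChar.map_neg_eq_conj, Complex.conj_im]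

theorem stdAddChar_im_neg_iff (d : ZMod n) : (stdAddChar d).im < 0 ↔ IsShortArc (-d) := by
  rw [← stdAddChar_im_pos_iff, stdAddChar_neg_im, neg_pos]

theorem minor_edgeNormal (t : Fin 3 → ZMod n) (m : Fin 3) :
    minor (edgeNormal n ∘ t) m = (stdAddChar (t (m + 2) - t (m + 1))).im := by
  rw [minor, cross, Function.comp_apply, Function.comp_apply, edgeNormal, edgeNormal, map_mul,
    mul_mul_mul_comm, conj_exp_mul_exp_ofReal_mul_I, conj_stdAddChar_mul_stdAddChar, sub_self,
    Complex.ofReal_zero, zero_mul, Complex.exp_zero, one_mul]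

/-- The triples of vertices of the regular `n`-gon, listed counterclockwise, which form an acute
triangle: by the inscribed angle theorem, those for which the arcs between them are short. -/
def orientedAcuteTriples (n : ℕ) [NeZero n] : Finset (Fin 3 → ZMod n) :=
  {t | ∀ m, IsShortArc (t (m + 2) - t (m + 1))}

/-- The triples of vertices of the regular `n`-gon which form an acute triangle. Negation, the
reflection in the real axis, exchanges the two orientations. -/
def acuteTriples (n : ℕ) [NeZero n] : Finset (Fin 3 → ZMod n) :=
  orientedAcuteTriples n ∪ -orientedAcuteTriples n

theorem mem_orientedAcuteTriples {t : Fin 3 → ZMod n} :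
    t ∈ orientedAcuteTriples n ↔ ∀ m, IsShortArc (t (m + 2) - t (m + 1)) := by
  simp [orientedAcuteTriples]

theorem neg_mem_orientedAcuteTriples {t : Fin 3 → ZMod n} :
    -t ∈ orientedAcuteTriples n ↔ ∀ m, IsShortArc (-(t (m + 2) - t (m + 1))) := by
  simp only [mem_orientedAcuteTriples, Pi.neg_apply, neg_sub_neg, neg_sub]

theorem isBalanced_edgeNormal_iff {t : Fin 3 → ZMod n} :
    IsBalanced (edgeNormal n ∘ t) ↔ t ∈ acuteTriples n := by
  simp only [IsBalanced, minor_edgeNormal, stdAddChar_im_pos_iff, stdAddChar_im_neg_iff,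
    acuteTriples, Finset.mem_union, Finset.mem_neg', neg_mem_orientedAcuteTriples]
  rw [mem_orientedAcuteTriples]

theorem card_acuteTriples : (acuteTriples n).card = 2 * (orientedAcuteTriples n).card := by
  have hdisj : Disjoint (orientedAcuteTriples n) (-orientedAcuteTriples n) := by
    refine Finset.disjoint_left.2 fun t ht ht' => ?_
    rw [Finset.mem_neg', neg_mem_orientedAcuteTriples] at ht'
    have hpos := (stdAddChar_im_pos_iff _).2 (mem_orientedAcuteTriples.1 ht 0)
    exact hpos.not_gt ((stdAddChar_im_neg_iff _).2 (ht' 0))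
  rw [acuteTriples, Finset.card_union_of_disjoint hdisj, Finset.card_neg, two_mul]

/-- The first two arcs of the acute triangles inscribed in the regular `n`-gon. -/
def acuteArcs (n : ℕ) [NeZero n] : Finset (ZMod n × ZMod n) :=
  {a | IsShortArc a.1 ∧ IsShortArc a.2 ∧ IsShortArc (-(a.1 + a.2))}

theorem card_orientedAcuteTriples :
    (orientedAcuteTriples n).card = n * (acuteArcs n).card := by
  have hcard : (orientedAcuteTriples n).card =
      ((Finset.univ : Finset (ZMod n)) ×ˢ acuteArcs n).card := by
    refine Finset.card_nbij' (fun t => (t 0, t 1 - t 0, t 2 - t 1))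
      (fun a => ![a.1, a.1 + a.2.1, a.1 + a.2.1 + a.2.2]) (fun t ht => ?_) (fun a ha => ?_)
      (fun t _ => ?_) (fun a _ => by simp)
    · have harcs := mem_orientedAcuteTriples.1 ht
      simpa [acuteArcs] using And.intro (harcs 2) ⟨harcs 0, harcs 1⟩
    · have harcs : IsShortArc a.2.1 ∧ IsShortArc a.2.2 ∧ IsShortArc (-(a.2.1 + a.2.2)) := by
        simpa [acuteArcs] using ha
      refine mem_orientedAcuteTriples.2 fun m => ?_
      fin_cases m
      · simpa using harcs.2.1
      · simpa [add_assoc] using harcs.2.2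
      · simpa using harcs.1
    · ext m
      fin_cases m <;> simp
  rw [hcard, Finset.card_product, Finset.card_univ, ZMod.card]

theorem isShortArc_neg_add_iff {p q : ZMod n} (hp : IsShortArc p) (hq : IsShortArc q) :
    IsShortArc (-(p + q)) ↔ n < 2 * (p.val + q.val) := by
  obtain ⟨hp₀, hp⟩ := hp
  obtain ⟨hq₀, hq⟩ := hq
  have hadd : (p + q).val = p.val + q.val := ZMod.val_add_of_lt (by omega)
  have hne : p + q ≠ 0 := fun h => by
    rw [h, ZMod.val_zero] at hadd
    omega
  rw [IsShortArc, ZMod.neg_val, if_neg hne, hadd]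
  omega

theorem mem_acuteArcs {h r : ℕ} (hr : r ≤ 1) (hn : n = 2 * h + 1 + r) {p q : ZMod n} :
    (p, q) ∈ acuteArcs n ↔ p.val ≤ h ∧ q.val ≤ h ∧ h + r < p.val + q.val := by
  simp only [acuteArcs, Finset.mem_filter_univ]
  constructor
  · rintro ⟨hp, hq, hpq⟩
    have hlarge := (isShortArc_neg_add_iff hp hq).1 hpq
    have := hp.2
    have := hq.2
    omega
  · rintro ⟨hp, hq, hpq⟩
    have hp' : IsShortArc p := ⟨by omega, by omega⟩
    have hq' : IsShortArc q := ⟨by omega, by omega⟩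
    exact ⟨hp', hq', (isShortArc_neg_add_iff hp' hq').2 (by omega)⟩

theorem card_acuteArcs {h r : ℕ} (hr : r ≤ 1) (hn : n = 2 * h + 1 + r) :
    (acuteArcs n).card = (h + 1 - r).choose 2 := by
  have hval : ∀ k ≤ h, (k : ZMod n).val = k := fun k hk => ZMod.val_cast_of_lt (by omega)
  have hcard : (acuteArcs n).card =
      ((Finset.range (h + 1 - r)).sigma fun i => Finset.range i).card := by
    refine Finset.card_nbij' (fun a => ⟨a.1.val - r, h - a.2.val⟩)
      (fun i => (((i.1 + r : ℕ) : ZMod n), ((h - i.2 : ℕ) : ZMod n)))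
      (fun a ha => ?_) (fun i hi => ?_) (fun a ha => ?_) (fun i hi => ?_)
    · have := (mem_acuteArcs hr hn).1 ha
      simp only [Finset.coe_sigma, Set.mem_sigma_iff, Finset.coe_range, Set.mem_Iio]
      omega
    · simp only [Finset.coe_sigma, Set.mem_sigma_iff, Finset.coe_range, Set.mem_Iio] at hi
      refine (mem_acuteArcs hr hn).2 ?_
      rw [hval _ (by omega), hval _ (by omega)]
      omega
    · have := (mem_acuteArcs hr hn).1 ha
      simp only
      rw [Nat.sub_add_cancel (by omega), Nat.sub_sub_self (by omega), ZMod.natCast_zmod_val,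
        ZMod.natCast_zmod_val]
    · simp only [Finset.coe_sigma, Set.mem_sigma_iff, Finset.coe_range, Set.mem_Iio] at hi
      simp only
      rw [hval _ (by omega), hval _ (by omega), Nat.add_sub_cancel, Nat.sub_sub_self (by omega)]
  simp only [hcard, Finset.card_sigma, Finset.card_range, Finset.sum_range_id,
    Nat.choose_two_right]

theorem card_acuteTriples_of_odd (hn : Odd n) :
    ((acuteTriples n).card : ℚ) = (n : ℚ) * (n + 1) * (n - 1) / 4 := by
  obtain ⟨h, hh⟩ := hn
  rw [card_acuteTriples, card_orientedAcuteTriples, card_acuteArcs zero_le_one hh, tsub_zero]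
  push_cast [Nat.cast_choose_two, hh]
  ring

theorem card_acuteTriples_of_even (hn : Even n) :
    ((acuteTriples n).card : ℚ) = (n : ℚ) * (n - 2) * (n - 4) / 4 := by
  obtain ⟨h, hh⟩ : ∃ h, n = 2 * h + 1 + 1 := by
    obtain ⟨k, hk⟩ := hn
    have := NeZero.pos n
    exact ⟨k - 1, by omega⟩
  rw [card_acuteTriples, card_orientedAcuteTriples, card_acuteArcs le_rfl hh, Nat.add_sub_cancel]
  push_cast [Nat.cast_choose_two, hh]
  ring

end Counting

/-! ### Vertices of rank two -/

section VertexCount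

variable {n : ℕ} [NeZero n] {V : Type*} [AddCommGroup V] [Module ℝ V]
  (b : AffineBasis (Fin 3) ℝ V)

omit [NeZero n] in
theorem cos_pi_div_pos (hn : 3 ≤ n) : 0 < Real.cos (Real.pi / n) := by
  have hn' : (2 : ℝ) < n := by exact_mod_cast hn
  have hpi := Real.pi_pos
  have hpos : 0 ≤ Real.pi / n := by positivity
  exact Real.cos_pos_of_mem_Ioo ⟨by linarith, by gcongr⟩

/-- The candidate for the vertex of `Hom (P_n, p)`, with `p` a triangle, which sends the edges
`t 0`, `t 1`, `t 2` of `P_n` into the three edges of `p`. -/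
noncomputable def polygonMap (p : Fin 3 → V) (t : Fin 3 → ZMod n) : ℂ →ᵃ[ℝ] V :=
  circumMap p (Real.cos (Real.pi / n)) (edgeNormal n ∘ t)

theorem coord_comp_polygonMap (hn : 3 ≤ n) {t : Fin 3 → ZMod n} (ht : t ∈ acuteTriples n)
    (m : Fin 3) : ∃ c : ℝ, 0 < c ∧ (b.coord m).comp (polygonMap b t) = c • edgeSlack n (t m) := by
  have hδ := cos_pi_div_pos hn
  have hbal := isBalanced_edgeNormal_iff.2 ht
  exact ⟨_, hbal.slackWeight_pos hδ m, hbal.coord_comp_circumMap b hδ.ne' m⟩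

theorem mem_homVerticesOfRank_two_iff (hn : 3 ≤ n) {f : ℂ →ᵃ[ℝ] V} :
    f ∈ homVerticesOfRank (regularPolygon n) (convexHull ℝ (Set.range b)) 2 ↔
      Function.Bijective f ∧ ∀ m, ∃ j, ∃ c : ℝ, 0 < c ∧ (b.coord m).comp f = c • edgeSlack n j := by
  have : FiniteDimensional ℝ V := b.finiteDimensional
  have hdim := finrank_eq_two_of_affineBasis b
  have hrank : homRank (regularPolygon n) f = 2 ↔ Function.Bijective f := by
    rw [← homRank_eq_finrank_iff_bijective (affineSpan_regularPolygon n hn)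
      (Complex.finrank_real_complex.trans hdim.symm) f, hdim]
  rw [homVerticesOfRank, Set.mem_ofPred_eq, hrank, and_comm]
  refine and_congr_right fun hbij => ?_
  have hne : ∀ m, (b.coord m).comp f ≠ 0 := fun m h0 => by
    obtain ⟨z, hz⟩ := hbij.2 (b m)
    simpa [hz] using DFunLike.congr_fun h0 z
  rw [regularPolygon_eq_convexHull_range_stdAddChar,
    mem_extremePoints_homPolytope_iff_isFacetDefining b (Set.finite_range _) hbij,
    mem_homPolytope_convexHull_iff, Set.forall_mem_range]
  constructor
  · rintro ⟨hnonneg, hfacet⟩ m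
    exact (isFacetDefining_range_stdAddChar_iff hn (hnonneg · m) (hne m)).1 (hfacet m)
  · intro hslack
    have hnonneg : ∀ (k : ZMod n) m, 0 ≤ b.coord m (f (stdAddChar k)) := fun k m => by
      obtain ⟨j, c, hc, hcoord⟩ := hslack m
      rw [← AffineMap.comp_apply, hcoord]
      exact mul_nonneg hc.le (edgeSlack_stdAddChar_nonneg j k)
    exact ⟨hnonneg, fun m =>
      (isFacetDefining_range_stdAddChar_iff hn (hnonneg · m) (hne m)).2 (hslack m)⟩

theorem homVerticesOfRank_two_eq_image (hn : 3 ≤ n) :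
    homVerticesOfRank (regularPolygon n) (convexHull ℝ (Set.range b)) 2 =
      polygonMap b '' (acuteTriples n : Set (Fin 3 → ZMod n)) := by
  ext f
  rw [mem_homVerticesOfRank_two_iff b hn]
  constructor
  · rintro ⟨hbij, hslack⟩
    choose t c hc hcoord using hslack
    obtain ⟨hbal, rfl⟩ := isBalanced_and_eq_circumMap b (u := edgeNormal n ∘ t) hbij.1 hc hcoord
    exact ⟨t, isBalanced_edgeNormal_iff.1 hbal, rfl⟩
  · rintro ⟨t, ht, rfl⟩
    exact ⟨(isBalanced_edgeNormal_iff.2 ht).circumMap_bijective b (cos_pi_div_pos hn),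
      fun m => ⟨t m, coord_comp_polygonMap b hn ht m⟩⟩

theorem injOn_polygonMap (hn : 3 ≤ n) :
    Set.InjOn (polygonMap b) (acuteTriples n : Set (Fin 3 → ZMod n)) := by
  intro t ht t' ht' heq
  ext1 m
  obtain ⟨c, -, hc⟩ := coord_comp_polygonMap b hn ht m
  obtain ⟨c', hpos, hc'⟩ := coord_comp_polygonMap b hn ht' m
  exact eq_of_smul_edgeSlack_eq_smul_edgeSlack hn hpos.ne' (by rw [← hc, heq, hc'])

end VertexCount

theorem mainTheorem8_general {V : Type*} [AddCommGroup V] [Module ℝ V]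
    (b : AffineBasis (Fin 3) ℝ V) (n : ℕ) (hn : 3 ≤ n) :
    (homVerticesOfRank (regularPolygon n) (convexHull ℝ (Set.range b)) 2).Finite ∧
    (Odd n →
      ((homVerticesOfRank (regularPolygon n) (convexHull ℝ (Set.range b)) 2).ncard : ℚ) =
        (n : ℚ) * (n + 1) * (n - 1) / 4) ∧
    (Even n →
      ((homVerticesOfRank (regularPolygon n) (convexHull ℝ (Set.range b)) 2).ncard : ℚ) =
        (n : ℚ) * (n - 2) * (n - 4) / 4) := by
  have : NeZero n := ⟨by omega⟩
  rw [homVerticesOfRank_two_eq_image b hn, (injOn_polygonMap b hn).ncard_image,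
    Set.ncard_coe_finset]
  exact ⟨(Finset.finite_toSet _).image _, card_acuteTriples_of_odd, card_acuteTriples_of_even⟩

/-- The vertices of `P_3` as an affine basis of the plane: barycentric coordinates with respect to
it describe `P_3` by inequalities. -/
noncomputable def regularTriangleBasis : AffineBasis (Fin 3) ℝ ℂ where
  toFun k := zeta 3 ^ (k : ℕ)
  ind' := by
    have hspan := affineSpan_regularPolygon 3 le_rfl
    rw [regularPolygon, affineSpan_convexHull] at hspan
    rw [affineIndependent_iff_finrank_vectorSpan_eq ℝ _ (Fintype.card_fin 3),
      ← direction_affineSpan, hspan, AffineSubspace.direction_top, finrank_top,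
      Complex.finrank_real_complex]
  tot' := by
    rw [← affineSpan_convexHull]
    exact affineSpan_regularPolygon 3 le_rfl

theorem mainTheorem8 (n : ℕ) (hn : 3 ≤ n) :
    (homVerticesOfRank (regularPolygon n) (regularPolygon 3) 2).Finite ∧
    (Odd n →
      ((homVerticesOfRank (regularPolygon n) (regularPolygon 3) 2).ncard : ℚ) =
        (n : ℚ) * (n + 1) * (n - 1) / 4) ∧
    (Even n →
      ((homVerticesOfRank (regularPolygon n) (regularPolygon 3) 2).ncard : ℚ) =
        (n : ℚ) * (n - 2) * (n - 4) / 4) :=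
  mainTheorem8_general regularTriangleBasis n hn
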